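/- Let $\mathbb K\in\{\mathbb R,\mathbb C\}$ and let $E$ be a locally convex topological vector space over $\mathbb K$ whose underlying topological space is a $k_\omega$-space; that is, $E$ is Hausdorff, there are countably many compact sets $K_1,K_2,\dots\subseteq E$ such that every compact subset of $E$ is contained in some $K_n$, and the topology of $E$ is the final topology induced by its compact subsets. Let $E'_{co}$ be the space of continuous linear functionals $E\to\mathbb K$, endowed with the compact-open topology. Then $E'_{co}$ is a locally convex nuclear vector space if and only if $E$ is a locally convex nuclear vector space. Here, for subsets $X,Y$ of a vector space $F$ over $\mathbb K$ and $k\in\{1,2,\dots\}$, put $$d_k(X,Y):=\inf\{c>0 \mid \exists\, L\le F \text{ a linear subspace with } \dim L<k \text{ and } X\subseteq cY+L\}\in[0,\infty]$$ (with $\inf\emptyset=\infty$). A locally convex vector space $F$ over $\mathbb K$ is called a locally convex nuclear vector space if for every symmetric ($-U=U$) and convex neighborhood $U$ of $0$ there is a symmetric and convex neighborhood $W$ of $0$ such that $d_k(W,U)\le 1/k$ for all $k\in\{1,2,\dots\}$. -/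

import Mathlib

open scoped Topology Pointwise ENNReal CompactConvergenceCLM

/-- A `k_ω`-space: a Hausdorff space which has a countable cobasis for the compact sets (countably
many compact sets such that every compact set is contained in one of them) and which carries the
final topology induced by its compact subsets. -/
structure IsKOmegaSpace (X : Type*) [TopologicalSpace X] : Prop where
  t2 : T2Space X
  exists_cobasis : ∃ K : ℕ → Set X,
    (∀ n, IsCompact (K n)) ∧ ∀ C : Set X, IsCompact C → ∃ n, C ⊆ K n
  final_topology : CompactlyCoherentSpace X

/-- A symmetric and convex subset of a (real or complex) vector space. -/
structure IsSymmConvex {E : Type*} [AddCommGroup E] [Module ℝ E] (U : Set E) : Prop where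
  neg_mem : ∀ x ∈ U, -x ∈ U
  convex : Convex ℝ U

/-- The Kolmogorov number
`d_k(X, Y) = inf {c > 0 | ∃ L ≤ E, dim L < k, X ⊆ c Y + L} ∈ [0, ∞]`, with `inf ∅ = ∞`.
The dimension is the cardinal-valued one, so that `L` is finite-dimensional. -/
noncomputable def kolmogorovNumber (𝕜 : Type*) [RCLike 𝕜] {E : Type*} [AddCommGroup E]
    [Module 𝕜 E] [Module ℝ E] (k : ℕ) (X Y : Set E) : ℝ≥0∞ :=
  sInf {d : ℝ≥0∞ | ∃ c : ℝ, 0 < c ∧ d = ENNReal.ofReal c ∧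
    ∃ L : Submodule 𝕜 E, Module.rank 𝕜 L < k ∧ X ⊆ c • Y + (L : Set E)}

/-- A locally convex nuclear vector space over `𝕜 = ℝ` or `ℂ`: a locally convex space such that
for every symmetric and convex neighbourhood `U` of `0` there is a symmetric and convex
neighbourhood `W` of `0` with `d_k(W, U) ≤ 1/k` for all `k = 1, 2, …`. -/
structure IsNuclearLCS (𝕜 : Type*) [RCLike 𝕜] (E : Type*) [AddCommGroup E] [Module 𝕜 E]
    [Module ℝ E] [IsScalarTower ℝ 𝕜 E] [TopologicalSpace E] [IsTopologicalAddGroup E]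
    [ContinuousSMul 𝕜 E] : Prop where
  locallyConvex : LocallyConvexSpace ℝ E
  exists_nhds : ∀ U ∈ 𝓝 (0 : E), IsSymmConvex U →
    ∃ W ∈ 𝓝 (0 : E), IsSymmConvex W ∧
      ∀ k : ℕ, 1 ≤ k → kolmogorovNumber 𝕜 k W U ≤ 1 / (k : ℝ≥0∞)

/-! Nuclearity is tested through determinants `det (f j (x i))`, which treat vectors and functionals
symmetrically and so pass between `E` and its dual.

Composing approximations turns Kolmogorov numbers `O(1/k)` into `O(k⁻ᵖ)` for larger `p`
(`HasApproxOrder.add`). Such decay writes the matrix as small entries plus low rank, so its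
determinant is at most `(D/k) ^ k` (`Matrix.norm_det_add_le`). Conversely, determinants bounded by
`c ^ k` give a subspace of dimension less than `k` with error `c`
(`exists_submodule_subset_of_norm_det_le`).

The `k_ω` property provides the neighbourhoods: an intersection of open sets `O n ⊇ K n` is open
(`isOpen_iInter_of_cobasis`). For the dual of a nuclear `E`, it shows by contradiction that the
polar of some `K n` works. For the converse, it makes open an intersection of thickened bipolars of
the `K n`, with thickness tuned to the approximation constants. -/

/-! ### Determinant estimates -/

theorem Matrix.norm_det_le_factorial_mul_prod {𝕜 : Type*} [RCLike 𝕜] {n : Type*} [Fintype n]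
    [DecidableEq n] (M : Matrix n n 𝕜) (b : n → ℝ) (hM : ∀ i j, ‖M i j‖ ≤ b i) :
    ‖M.det‖ ≤ (Fintype.card n).factorial * ∏ i, b i := by
  rw [← Matrix.det_transpose, Matrix.det_apply]
  calc _ ≤ ∑ σ : Equiv.Perm n, ‖Equiv.Perm.sign σ • ∏ i, M.transpose (σ i) i‖ := norm_sum_le _ _
    _ ≤ ∑ _σ : Equiv.Perm n, ∏ i, b i := by
        refine Finset.sum_le_sum fun σ _ => ?_
        have : ‖Equiv.Perm.sign σ • ∏ i, M.transpose (σ i) i‖ = ∏ i, ‖M i (σ i)‖ := by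
          rcases Int.units_eq_one_or (Equiv.Perm.sign σ) with h | h <;>
            simp [h, Units.smul_def, norm_prod, Matrix.transpose_apply]
        rw [this]
        exact Finset.prod_le_prod (fun _ _ => norm_nonneg _) fun i _ => hM i _
    _ = _ := by simp [Fintype.card_perm]

theorem Matrix.det_eq_zero_of_rows_mem {𝕜 : Type*} [Field 𝕜] {n : Type*} [Fintype n]
    [DecidableEq n] (M : Matrix n n 𝕜) (L : Submodule 𝕜 (n → 𝕜)) (s : Finset n)
    (hs : ∀ i ∈ s, M i ∈ L) (hcard : Module.finrank 𝕜 L < s.card) : M.det = 0 := by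
  refine (Matrix.detRowAlternating (R := 𝕜) (n := n)).map_linearDependent M fun hli => ?_
  let v : s → L := fun i => ⟨M i, hs i i.2⟩
  have hv : LinearIndependent 𝕜 v := by
    apply LinearIndependent.of_comp L.subtype
    exact hli.comp (fun i : s => (i : n)) Subtype.val_injective
  have := hv.fintype_card_le_finrank
  simp at this
  omega

/-- If `S` has entries at most `C r⁻⁴` and `Q` is bounded with rank less than `r ≈ N / 2`, then
`det (S + Q)` decays like `N⁻ᴺ`. -/
theorem Matrix.norm_det_add_le {𝕜 : Type*} [RCLike 𝕜] {N r : ℕ} (hN : 1 ≤ N)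
    (hNr : N ≤ 2 * r) (hr1 : 2 * r ≤ N + 1)
    (S Q : Matrix (Fin N) (Fin N) 𝕜) {C : ℝ} (hC : 1 ≤ C)
    (hS : ∀ i j, ‖S i j‖ ≤ C / r ^ 4) (hQ : ∀ i j, ‖Q i j‖ ≤ C)
    (L : Submodule 𝕜 (Fin N → 𝕜)) (hL : Module.finrank 𝕜 L < r) (hQL : ∀ i, Q i ∈ L) :
    ‖(S + Q).det‖ ≤ (8 * C / N) ^ N := by
  have hr0 : 1 ≤ r := by omega
  have hrR : (1 : ℝ) ≤ r := by exact_mod_cast hr0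
  have hexp : (S + Q).det = ∑ s : Finset (Fin N), Matrix.det (s.piecewise Q S) := by
    rw [add_comm]
    exact (Matrix.detRowAlternating (R := 𝕜) (n := Fin N)).map_add_univ Q S
  have hmem : ∀ (s : Finset (Fin N)), ∀ i ∈ s,
      Finset.piecewise (π := fun _ => Fin N → 𝕜) s Q S i = Q i :=
    fun s i hi => Finset.piecewise_eq_of_mem (π := fun _ => Fin N → 𝕜) s Q S hi
  have hnot : ∀ (s : Finset (Fin N)), ∀ i ∉ s,
      Finset.piecewise (π := fun _ => Fin N → 𝕜) s Q S i = S i :=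
    fun s i hi => Finset.piecewise_eq_of_notMem (π := fun _ => Fin N → 𝕜) s Q S hi
  have hterm : ∀ s : Finset (Fin N), ‖Matrix.det (s.piecewise Q S)‖ ≤
      N.factorial * (C ^ N * (4 / (N : ℝ) ^ 2) ^ N) := by
    intro s
    have hpos : 0 ≤ (N.factorial : ℝ) * (C ^ N * (4 / (N : ℝ) ^ 2) ^ N) := by positivity
    -- Rows are chosen from `Q` on `s` and from `S` off `s`. Too many rows in `L` are dependent;
    -- otherwise at least `r` rows come from `S`, contributing `r⁻⁴ʳ ≤ (4 / N²)ᴺ`, of which `N!`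
    -- consumes only one factor `Nᴺ`.
    rcases lt_or_ge (Module.finrank 𝕜 L) s.card with h | h
    · rw [Matrix.det_eq_zero_of_rows_mem (s.piecewise Q S) L s
        (fun i hi => (hmem s i hi).symm ▸ hQL i) h]
      simpa using hpos
    · have h1 := Matrix.norm_det_le_factorial_mul_prod (𝕜 := 𝕜) (s.piecewise Q S)
        (s.piecewise (fun _ => C) (fun _ => C / r ^ 4)) (fun i j => by
          by_cases hi : i ∈ s
          · rw [Finset.piecewise_eq_of_mem _ _ _ hi, congrFun (hmem s i hi) j]
            exact hQ i j
          · rw [Finset.piecewise_eq_of_notMem _ _ _ hi, congrFun (hnot s i hi) j]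
            exact hS i j)
      refine h1.trans ?_
      rw [Fintype.card_fin]
      gcongr
      have h2 : ∏ i, s.piecewise (fun _ => C) (fun _ => C / (r : ℝ) ^ 4) i
          = C ^ N * ((1 / (r : ℝ) ^ 4) ^ (N - s.card)) := by
        rw [Finset.prod_piecewise]
        simp only [Finset.univ_inter, Finset.prod_const, div_eq_mul_one_div C, mul_pow, one_div]
        rw [← mul_assoc, ← pow_add, ← Finset.compl_eq_univ_sdiff, Finset.card_compl,
          Fintype.card_fin, Nat.add_sub_cancel' (by omega)]
      rw [h2]
      gcongr
      have h3 : (1 / (r : ℝ) ^ 4) ^ (N - s.card) ≤ (1 / (r : ℝ) ^ 4) ^ r :=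
        pow_le_pow_of_le_one (by positivity) (by
          rw [div_le_one (by positivity)]; exact one_le_pow₀ hrR) (by omega)
      have h4 : (1 / (r : ℝ) ^ 4) ^ r = (1 / (r : ℝ) ^ 2) ^ (2 * r) := by
        rw [pow_mul, div_pow 1 _ 2, one_pow, ← pow_mul]
      have h5 : (1 / (r : ℝ) ^ 2) ^ (2 * r) ≤ (1 / (r : ℝ) ^ 2) ^ N :=
        pow_le_pow_of_le_one (by positivity) (by
          rw [div_le_one (by positivity)]; exact one_le_pow₀ hrR) hNr
      refine h3.trans (h4.le.trans (h5.trans ?_))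
      refine pow_le_pow_left₀ (by positivity) ?_ _
      rw [div_le_div_iff₀ (by positivity) (by positivity)]
      have : (N : ℝ) ≤ 2 * r := by exact_mod_cast hNr
      nlinarith
  have hfac : (N.factorial : ℝ) ≤ (N : ℝ) ^ N := by exact_mod_cast N.factorial_le_pow
  calc ‖(S + Q).det‖ ≤ ∑ s : Finset (Fin N), ‖Matrix.det (s.piecewise Q S)‖ := by
        rw [hexp]; exact norm_sum_le _ _
    _ ≤ ∑ _s : Finset (Fin N), N.factorial * (C ^ N * (4 / (N : ℝ) ^ 2) ^ N) :=
        Finset.sum_le_sum fun s _ => hterm s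
    _ = 2 ^ N * (N.factorial * (C ^ N * (4 / (N : ℝ) ^ 2) ^ N)) := by simp
    _ ≤ 2 ^ N * ((N : ℝ) ^ N * (C ^ N * (4 / (N : ℝ) ^ 2) ^ N)) := by gcongr
    _ = (8 * C / N) ^ N := by
        simp only [← mul_pow]
        congr 1
        field_simp
        norm_num

/-! ### From determinants to approximating subspaces and back -/

/-- Bounds on all determinants `det (φ j (a i))` yield an approximation of `A` by a subspace. -/
theorem exists_submodule_subset_of_norm_det_le {𝕜 G : Type*} [RCLike 𝕜] [AddCommGroup G]
    [Module 𝕜 G] [Module ℝ G] [IsScalarTower ℝ 𝕜 G] {A : Set G} {Φ : Set (Module.Dual 𝕜 G)}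
    {c : ℝ} (hc : 0 < c) {k : ℕ} (hk : 1 ≤ k)
    (hdet : ∀ (a : Fin k → G) (φ : Fin k → Module.Dual 𝕜 G), (∀ i, a i ∈ A) → (∀ j, φ j ∈ Φ) →
      ‖(Matrix.of fun i j => φ j (a i)).det‖ ≤ c ^ k) :
    ∃ L : Submodule 𝕜 G, Module.rank 𝕜 L < k ∧
      A ⊆ c • {g | ∀ φ ∈ Φ, ‖φ g‖ ≤ 1} + (L : Set G) := by
  -- Choose a size `m` with a determinant at least `c ^ m` while all those of size `m + 1` are at
  -- most `c ^ (m + 1)`. It exists because the empty determinant is `1 = c ^ 0`.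
  obtain ⟨m, hm, ⟨a, φ, ha, hφ, hge⟩, hle⟩ : ∃ m < k,
      (∃ (a : Fin m → G) (φ : Fin m → Module.Dual 𝕜 G), (∀ i, a i ∈ A) ∧ (∀ j, φ j ∈ Φ) ∧
        c ^ m ≤ ‖(Matrix.of fun i j => φ j (a i)).det‖) ∧
      ∀ (a : Fin (m + 1) → G) (φ : Fin (m + 1) → Module.Dual 𝕜 G), (∀ i, a i ∈ A) →
        (∀ j, φ j ∈ Φ) → ‖(Matrix.of fun i j => φ j (a i)).det‖ ≤ c ^ (m + 1) := by
    by_contra! hcon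
    have key : ∀ m ≤ k, ∃ (a : Fin m → G) (φ : Fin m → Module.Dual 𝕜 G), (∀ i, a i ∈ A) ∧
        (∀ j, φ j ∈ Φ) ∧ c ^ m ≤ ‖(Matrix.of fun i j => φ j (a i)).det‖ := by
      intro m
      induction m with
      | zero => exact fun _ => ⟨Fin.elim0, Fin.elim0, fun i => i.elim0, fun i => i.elim0, by simp⟩
      | succ m ih =>
        intro hm
        obtain ⟨a, φ, ha, hφ, h⟩ := hcon m hm (ih (by omega))
        exact ⟨a, φ, ha, hφ, h.le⟩
    obtain ⟨m, rfl⟩ : ∃ m, k = m + 1 := ⟨k - 1, by omega⟩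
    obtain ⟨a, φ, ha, hφ, h⟩ := hcon m (by omega) (key m (by omega))
    exact absurd (hdet a φ ha hφ) (not_le.2 h)
  set M : Matrix (Fin m) (Fin m) 𝕜 := Matrix.of fun i j => φ j (a i) with hM
  have hMpos : 0 < ‖M.det‖ := (pow_pos hc m).trans_le hge
  have hMdet : M.det ≠ 0 := norm_pos_iff.1 hMpos
  let : Invertible M := Matrix.invertibleOfIsUnitDet M (isUnit_iff_ne_zero.2 hMdet)
  refine ⟨Submodule.span 𝕜 (Set.range a), ?_, fun g hg => ?_⟩
  · refine (rank_span_le _).trans_lt ?_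
    have := Cardinal.mk_range_le_lift (f := a)
    simp only [Cardinal.lift_id', Cardinal.mk_fin, Cardinal.lift_natCast] at this
    exact this.trans_lt (by exact_mod_cast hm)
  let l : Matrix Unit (Fin m) 𝕜 := (Matrix.of fun _ j => φ j g) * ⅟M
  -- The coefficients make every `φ j` vanish on `g'`, and `ψ g'` is the Schur complement of `M` in
  -- the matrix bordered by `g` and `ψ`. Hence it is a quotient of consecutive determinants, bounded
  -- by `c`.
  set g' : G := g - ∑ i, l () i • a i with hg'
  have hbound : ∀ ψ ∈ Φ, ‖ψ g'‖ ≤ c := by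
    intro ψ hψ
    have hsnoc := hle (Fin.snoc a g) (Fin.snoc φ ψ)
      (fun i => by refine Fin.lastCases ?_ (fun i => ?_) i <;> simp [hg, ha])
      (fun i => by refine Fin.lastCases ?_ (fun i => ?_) i <;> simp [hψ, hφ])
    have hblock : (Matrix.of fun i j => (Fin.snoc φ ψ : Fin (m + 1) → Module.Dual 𝕜 G) j
        ((Fin.snoc a g : Fin (m + 1) → G) i)).det = M.det * ψ g' := by
      let e : Fin m ⊕ Unit ≃ Fin (m + 1) :=
        (Equiv.sumCongr (Equiv.refl _) (Equiv.ofUnique Unit (Fin 1))).trans finSumFinEquiv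
      have he1 : ∀ i, e (Sum.inl i) = Fin.castSucc i := fun i => by
        simp [e, Fin.ext_iff]
      have he2 : ∀ i, e (Sum.inr i) = Fin.last m := fun i => by
        simp only [e, Equiv.trans_apply, Equiv.sumCongr_apply, Sum.map_inr,
          finSumFinEquiv_apply_right]
        ext; simp
      rw [← Matrix.det_submatrix_equiv_self e]
      have : (Matrix.of fun i j => (Fin.snoc φ ψ : Fin (m + 1) → Module.Dual 𝕜 G) j
          ((Fin.snoc a g : Fin (m + 1) → G) i)).submatrix e e =
          Matrix.fromBlocks M (Matrix.of fun i (_ : Unit) => ψ (a i))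
            (Matrix.of fun (_ : Unit) j => φ j g) (Matrix.of fun _ _ => ψ g) := by
        ext i j
        rcases i with i | i <;> rcases j with j | j <;>
          simp [he1, he2, hM, Matrix.submatrix_apply]
      rw [this, Matrix.det_fromBlocks₁₁]
      congr 1
      rw [Matrix.det_unique, hg']
      simp [l, Matrix.mul_apply, map_sum]
    rw [hblock, norm_mul] at hsnoc
    have : ‖M.det‖ * ‖ψ g'‖ ≤ ‖M.det‖ * c := hsnoc.trans (by
      rw [pow_succ]; gcongr)
    exact le_of_mul_le_mul_left this hMpos
  refine Set.mem_add.2 ⟨g', ?_, ∑ i, l () i • a i, ?_, by simp [hg']⟩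
  · rw [Set.mem_smul_set_iff_inv_smul_mem₀ hc.ne']
    intro ψ hψ
    rw [← algebraMap_smul 𝕜 c⁻¹ g', map_smul, norm_smul]
    simp only [norm_algebraMap', norm_inv, Real.norm_eq_abs, abs_of_pos hc]
    rw [inv_mul_le_iff₀ hc, mul_one]
    exact hbound ψ hψ
  · exact Submodule.sum_mem _ fun i _ => Submodule.smul_mem _ _
      (Submodule.subset_span ⟨i, rfl⟩)

/-- The rows `(ψ j (l i))_j` lie in the image of `L` under `LinearMap.pi ψ`, so they span a space of
dimension less than `r`. -/
theorem norm_det_le_of_eq_add {𝕜 G : Type*} [RCLike 𝕜] [AddCommGroup G] [Module 𝕜 G] {N r : ℕ}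
    (hN : 1 ≤ N) (hNr : N ≤ 2 * r) (hrN : 2 * r ≤ N + 1) {M : Matrix (Fin N) (Fin N) 𝕜}
    (S : Matrix (Fin N) (Fin N) 𝕜) {L : Submodule 𝕜 G} (hL : Module.rank 𝕜 L < r)
    {l : Fin N → G} (hl : ∀ i, l i ∈ L) (ψ : Fin N → Module.Dual 𝕜 G)
    (hM : ∀ i j, M i j = S i j + ψ j (l i)) {C : ℝ} (hC : 1 ≤ C)
    (hS : ∀ i j, ‖S i j‖ ≤ C / r ^ 4) (hQ : ∀ i j, ‖ψ j (l i)‖ ≤ C) :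
    ‖M.det‖ ≤ (8 * C / N) ^ N := by
  have hfin : Module.Finite 𝕜 L :=
    Module.rank_lt_aleph0_iff.1 (hL.trans Cardinal.natCast_lt_aleph0)
  have hM' : M = S + Matrix.of fun i j => ψ j (l i) := by
    ext i j
    simp [hM]
  rw [hM']
  refine Matrix.norm_det_add_le hN hNr hrN S _ hC hS hQ (L.map (LinearMap.pi ψ)) ?_
    fun i => ⟨l i, hl i, rfl⟩
  refine (Submodule.finrank_map_le _ _).trans_lt ?_
  rw [← Module.finrank_eq_rank] at hL
  exact_mod_cast hL

/-! ### Rates of approximation and nuclearity -/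

/-- Every neighbourhood `U` of `0` admits a neighbourhood `W` of `0` whose Kolmogorov numbers
with respect to `U` are `O(k⁻ᵖ)`. -/
def HasApproxOrder (𝕜 E : Type*) [RCLike 𝕜] [AddCommGroup E] [Module 𝕜 E] [Module ℝ E]
    [TopologicalSpace E] (p : ℕ) : Prop :=
  ∀ U ∈ 𝓝 (0 : E), ∃ W ∈ 𝓝 (0 : E), ∃ C : ℝ, 0 < C ∧ ∀ k : ℕ, 1 ≤ k →
    ∃ c : ℝ, 0 < c ∧ c ≤ C / (k : ℝ) ^ p ∧ ∃ L : Submodule 𝕜 E, Module.rank 𝕜 L < k ∧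
      W ⊆ c • U + (L : Set E)

section

variable {𝕜 : Type*} [RCLike 𝕜] {E : Type*} [AddCommGroup E] [Module 𝕜 E] [Module ℝ E]

theorem HasApproxOrder.add [IsScalarTower ℝ 𝕜 E] [TopologicalSpace E] {p q : ℕ}
    (hp : HasApproxOrder 𝕜 E p) (hq : HasApproxOrder 𝕜 E q) : HasApproxOrder 𝕜 E (p + q) := by
  intro U hU
  obtain ⟨V, hV, C₂, hC₂, h₂⟩ := hq U hU
  obtain ⟨W, hW, C₁, hC₁, h₁⟩ := hp V hV
  refine ⟨W, hW, C₁ * C₂ * 2 ^ (p + q), by positivity, fun k hk => ?_⟩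
  -- Two subspaces of dimension at most `m - 1` have a sum of dimension at most `2 * m - 2 < k`.
  obtain ⟨m, hm1, hkm, hmk⟩ : ∃ m, 1 ≤ m ∧ k ≤ 2 * m ∧ 2 * m ≤ k + 1 :=
    ⟨(k + 1) / 2, by omega, by omega, by omega⟩
  obtain ⟨c₁, hc₁, hc₁', L₁, hL₁, hW₁⟩ := h₁ m hm1
  obtain ⟨c₂, hc₂, hc₂', L₂, hL₂, hW₂⟩ := h₂ m hm1
  have hm0 : (0 : ℝ) < m := by exact_mod_cast hm1
  have hk0 : (0 : ℝ) < k := by exact_mod_cast hk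
  have hkm' : (k : ℝ) ≤ 2 * m := by exact_mod_cast hkm
  refine ⟨c₁ * c₂, by positivity, ?_, L₁ ⊔ L₂, ?_, ?_⟩
  · calc c₁ * c₂ ≤ (C₁ / (m : ℝ) ^ p) * (C₂ / (m : ℝ) ^ q) := by gcongr
      _ = C₁ * C₂ / (m : ℝ) ^ (p + q) := by rw [pow_add]; field_simp
      _ ≤ C₁ * C₂ * 2 ^ (p + q) / (k : ℝ) ^ (p + q) := by
        rw [div_le_div_iff₀ (by positivity) (by positivity), mul_assoc (C₁ * C₂), ← mul_pow]
        gcongr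
  · obtain ⟨a, ha⟩ := Cardinal.lt_aleph0.1 (hL₁.trans Cardinal.natCast_lt_aleph0)
    obtain ⟨b, hb⟩ := Cardinal.lt_aleph0.1 (hL₂.trans Cardinal.natCast_lt_aleph0)
    refine (Submodule.rank_add_le_rank_add_rank L₁ L₂).trans_lt ?_
    rw [ha] at hL₁
    rw [hb] at hL₂
    rw [ha, hb]
    norm_cast at hL₁ hL₂ ⊢
    omega
  · intro x hx
    obtain ⟨_, ⟨v, hv, rfl⟩, l₁, hl₁, rfl⟩ := Set.mem_add.1 (hW₁ hx)
    obtain ⟨_, ⟨u, hu, rfl⟩, l₂, hl₂, rfl⟩ := Set.mem_add.1 (hW₂ hv)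
    refine Set.mem_add.2 ⟨(c₁ * c₂) • u, ⟨u, hu, rfl⟩, c₁ • l₂ + l₁, ?_, ?_⟩
    · refine add_mem ?_ (Submodule.mem_sup_left hl₁)
      rw [← algebraMap_smul 𝕜 c₁ l₂]
      exact Submodule.smul_mem _ _ (Submodule.mem_sup_right hl₂)
    · simp only [smul_add, mul_smul, add_assoc]

theorem IsNuclearLCS.hasApproxOrder_one [IsScalarTower ℝ 𝕜 E] [TopologicalSpace E]
    [IsTopologicalAddGroup E] [ContinuousSMul 𝕜 E] (h : IsNuclearLCS 𝕜 E) :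
    HasApproxOrder 𝕜 E 1 := by
  intro U hU
  have : LocallyConvexSpace ℝ E := h.locallyConvex
  obtain ⟨U', ⟨hU', hconv⟩, hU'U⟩ := (LocallyConvexSpace.convex_basis_zero ℝ E).mem_iff.1 hU
  have hneg : IsSymmConvex (U' ∩ -U') :=
    ⟨fun x hx => ⟨by simpa using hx.2, by simpa using hx.1⟩, hconv.inter hconv.neg⟩
  obtain ⟨W, hW, -, hk⟩ := h.exists_nhds (U' ∩ -U')
    (Filter.inter_mem hU' (by simpa using neg_mem_nhds_zero E hU')) hneg
  -- The infimum need not be attained; the constant `2` leaves room for an actual `c`.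
  refine ⟨W, hW, 2, two_pos, fun k hk1 => ?_⟩
  have hk0 : (0 : ℝ) < k := by exact_mod_cast hk1
  have hlt : kolmogorovNumber 𝕜 k W (U' ∩ -U') < ENNReal.ofReal (2 / k) := by
    refine (hk k hk1).trans_lt ?_
    rw [ENNReal.ofReal_div_of_pos hk0, ENNReal.ofReal_natCast]
    refine ENNReal.div_lt_div_right (by positivity) (by simp) ?_
    simp
  obtain ⟨d, ⟨c, hc, rfl, L, hL, hsub⟩, hd⟩ := sInf_lt_iff.1 hlt
  refine ⟨c, hc, ?_, L, hL, hsub.trans ?_⟩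
  · rw [pow_one]
    exact ((ENNReal.ofReal_lt_ofReal_iff (by positivity)).1 hd).le
  · exact Set.add_subset_add_right (Set.smul_set_mono (Set.inter_subset_left.trans hU'U))

theorem IsNuclearLCS.of_approx [IsScalarTower ℝ 𝕜 E] [TopologicalSpace E]
    [IsTopologicalAddGroup E] [ContinuousSMul 𝕜 E] [LocallyConvexSpace ℝ E]
    (h : ∀ U ∈ 𝓝 (0 : E), ∃ W ∈ 𝓝 (0 : E), IsSymmConvex W ∧ ∃ R : ℝ, 0 < R ∧ ∀ k : ℕ, 1 ≤ k →
      ∃ L : Submodule 𝕜 E, Module.rank 𝕜 L < k ∧ W ⊆ (R / k) • U + (L : Set E)) :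
    IsNuclearLCS 𝕜 E where
  locallyConvex := inferInstance
  exists_nhds U hU _ := by
    obtain ⟨W, hW, hWs, R, hR, hk⟩ := h U hU
    have : ContinuousSMul ℝ E := IsScalarTower.continuousSMul 𝕜
    refine ⟨R⁻¹ • W, by simpa using set_smul_mem_nhds_zero_iff (inv_ne_zero hR.ne') |>.2 hW,
      ⟨?_, hWs.convex.smul _⟩, fun k hk1 => ?_⟩
    · rintro _ ⟨w, hw, rfl⟩
      exact ⟨-w, hWs.neg_mem w hw, by simp⟩
    · have hk0 : (0 : ℝ) < k := by exact_mod_cast hk1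
      obtain ⟨L, hL, hsub⟩ := hk k hk1
      refine sInf_le ⟨1 / k, by positivity, ?_, L, hL, ?_⟩
      · rw [ENNReal.ofReal_div_of_pos hk0]
        simp
      · rintro _ ⟨w, hw, rfl⟩
        obtain ⟨_, ⟨u, hu, rfl⟩, l, hl, rfl⟩ := Set.mem_add.1 (hsub hw)
        refine Set.mem_add.2 ⟨(1 / k : ℝ) • u, ⟨u, hu, rfl⟩, R⁻¹ • l, ?_, ?_⟩
        · rw [← algebraMap_smul 𝕜 R⁻¹ l]
          exact Submodule.smul_mem _ _ hl
        · simp only [smul_add, smul_smul]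
          congr 2
          field_simp

/-! ### Compact sets, norming functionals and `k_ω`-spaces -/

theorem IsCompact.exists_pos_subset_smul [TopologicalSpace E] [IsTopologicalAddGroup E]
    [ContinuousSMul ℝ E] {K U : Set E} (hK : IsCompact K) (hU : U ∈ 𝓝 (0 : E)) :
    ∃ s : ℝ, 0 < s ∧ K ⊆ s • U := by
  obtain ⟨r, hr, h⟩ := (hK.isVonNBounded ℝ hU).exists_pos
  exact ⟨r, hr, h r (by simp [abs_of_pos hr])⟩

open scoped ComplexOrder in
theorem exists_seminorm_le_one_subset [IsScalarTower ℝ 𝕜 E] [TopologicalSpace E]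
    [IsTopologicalAddGroup E] [ContinuousSMul 𝕜 E] [LocallyConvexSpace ℝ E] {U : Set E}
    (hU : U ∈ 𝓝 (0 : E)) :
    ∃ p : Seminorm 𝕜 E, Continuous p ∧ {x | p x ≤ 1} ⊆ U ∧
      ∀ x, ∃ f : StrongDual 𝕜 E, (∀ y, ‖f y‖ ≤ p y) ∧ ‖f x‖ = p x := by
  have : ContinuousSMul ℝ E := IsScalarTower.continuousSMul 𝕜
  have hlc : LocallyConvexSpace 𝕜 E := by
    refine (locallyConvexSpace_iff_zero 𝕜 E).2 ?_
    simpa only [convex_RCLike_iff_convex_real] using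
      (locallyConvexSpace_iff_zero ℝ E).1 inferInstance
  obtain ⟨s, ⟨h0, hso, hs⟩, hsU⟩ := (nhds_hasBasis_absConvex_open 𝕜 E).mem_iff.1 hU
  let q : Seminorm 𝕜 E := gaugeSeminormFamily 𝕜 E ⟨s, h0, hso, hs⟩
  have hq : Continuous q := (with_gaugeSeminormFamily (𝕜 := 𝕜) (E := E)).continuous_seminorm _
  have hqs : q.ball 0 1 = s := gaugeSeminormFamily_ball (𝕜 := 𝕜) (E := E) ⟨s, h0, hso, hs⟩
  -- Doubling the gauge puts the closed unit ball inside the open gauge ball `s`.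
  have hp : Continuous ((2 : NNReal) • q : Seminorm 𝕜 E) := hq.const_smul (2 : NNReal)
  refine ⟨(2 : NNReal) • q, hp, fun x hx => hsU ?_, fun x => ?_⟩
  · rw [id, ← hqs, Seminorm.mem_ball_zero]
    have hx' : 2 * q x ≤ 1 := hx
    linarith
  generalize (2 : NNReal) • q = p at hp
  by_cases hx : p x = 0
  · exact ⟨0, fun y => by simp, by simp [hx]⟩
  have hx0 : x ≠ 0 := by
    rintro rfl
    exact hx (map_zero p)
  let e := LinearEquiv.toSpanNonzeroSingleton 𝕜 E x hx0
  obtain ⟨f, hf, hfp⟩ := Module.Dual.exists_continuous_extension_of_le_seminorm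
    (Submodule.span 𝕜 {x}) ((p x : 𝕜) • (e.symm : _ →ₗ[𝕜] 𝕜)) hp (fun y => by
      obtain ⟨c, rfl⟩ := e.surjective y
      have : ((e c : Submodule.span 𝕜 {x}) : E) = c • x := rfl
      simp [this, map_smul_eq_mul, norm_smul, abs_of_nonneg (apply_nonneg p x), mul_comm])
  refine ⟨f, hfp, ?_⟩
  have h1 := hf (e 1)
  have h2 : ((e 1 : Submodule.span 𝕜 {x}) : E) = x := one_smul 𝕜 x
  rw [h2] at h1
  simp [h1, abs_of_nonneg (apply_nonneg p x)]

theorem IsKOmegaSpace.exists_monotone_cobasis {X : Type*} [TopologicalSpace X]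
    (h : IsKOmegaSpace X) : ∃ K : ℕ → Set X, Monotone K ∧ (∀ n, IsCompact (K n)) ∧
      ∀ C : Set X, IsCompact C → ∃ n, C ⊆ K n := by
  obtain ⟨K, hK, hC⟩ := h.exists_cobasis
  refine ⟨Set.accumulate K, Set.monotone_accumulate, fun n => ?_, fun C hCc => ?_⟩
  · exact (Set.finite_le_nat n).isCompact_biUnion fun i _ => hK i
  · obtain ⟨n, hn⟩ := hC C hCc
    exact ⟨n, hn.trans (Set.subset_accumulate)⟩

/-- On a compact `C ⊆ K m` only the finitely many `O n` with `n < m` impose a condition, since `C ⊆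
K n ⊆ O n` for `n ≥ m`. -/
theorem isOpen_iInter_of_cobasis {X : Type*} [TopologicalSpace X] [CompactlyCoherentSpace X]
    {K : ℕ → Set X} (hmono : Monotone K) (hC : ∀ C : Set X, IsCompact C → ∃ n, C ⊆ K n)
    {O : ℕ → Set X} (hO : ∀ n, IsOpen (O n)) (hKO : ∀ n, K n ⊆ O n) : IsOpen (⋂ n, O n) := by
  refine CompactlyCoherentSpace.isOpen_iff.2 fun C hCc => ?_
  obtain ⟨m, hm⟩ := hC C hCc
  have : (Subtype.val ⁻¹' (⋂ n, O n) : Set C) = Subtype.val ⁻¹' (⋂ n ∈ Set.Iio m, O n) := by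
    ext x
    simp only [Set.mem_preimage, Set.mem_iInter, Set.mem_Iio]
    refine ⟨fun h n _ => h n, fun h n => ?_⟩
    rcases lt_or_ge n m with hn | hn
    · exact h n hn
    · exact hKO n (hmono hn (hm x.2))
  rw [this]
  exact ((Set.finite_Iio m).isOpen_biInter fun n _ => hO n).preimage continuous_subtype_val

end

theorem norm_map_real_smul {𝕜 : Type*} [RCLike 𝕜] {G : Type*} [AddCommGroup G]
    [Module 𝕜 G] [Module ℝ G] [IsScalarTower ℝ 𝕜 G] (ψ : Module.Dual 𝕜 G) (c : ℝ) (x : G) :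
    ‖ψ (c • x)‖ = |c| * ‖ψ x‖ := by
  rw [← algebraMap_smul 𝕜 c x, map_smul, norm_smul, norm_algebraMap', Real.norm_eq_abs]

/-! ### The dual with the compact-open topology -/

section

variable {𝕜 : Type*} [RCLike 𝕜] {E : Type*} [AddCommGroup E] [Module 𝕜 E]
  [TopologicalSpace E]

/-- Evaluation at a point, as a linear functional on the dual with the compact-open topology. -/
def evalDual (𝕜 : Type*) [RCLike 𝕜] {E : Type*} [AddCommGroup E] [Module 𝕜 E]
    [TopologicalSpace E] (x : E) : Module.Dual 𝕜 (E →L_c[𝕜] 𝕜) where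
  toFun f := f x
  map_add' _ _ := rfl
  map_smul' _ _ := rfl

@[simp]
theorem evalDual_apply (x : E) (f : E →L_c[𝕜] 𝕜) : evalDual 𝕜 x f = f x := rfl

theorem CompactConvergenceCLM.polar_mem_nhds {K : Set E} (hK : IsCompact K) {ε : ℝ}
    (hε : 0 < ε) : {f : E →L_c[𝕜] 𝕜 | ∀ x ∈ K, ‖f x‖ ≤ ε} ∈ 𝓝 0 := by
  refine (CompactConvergenceCLM.hasBasis_nhds_zero_of_basis
    (Metric.nhds_basis_closedBall (x := (0 : 𝕜)))).mem_iff.2 ⟨(K, ε), ⟨hK, hε⟩, fun f hf x hx => ?_⟩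
  simpa using hf x hx

theorem CompactConvergenceCLM.exists_polar_subset [ContinuousConstSMul 𝕜 E]
    {V : Set (E →L_c[𝕜] 𝕜)} (hV : V ∈ 𝓝 0) :
    ∃ K : Set E, IsCompact K ∧ {f : E →L_c[𝕜] 𝕜 | ∀ x ∈ K, ‖f x‖ ≤ 1} ⊆ V := by
  obtain ⟨⟨K, ε⟩, ⟨hK, hε⟩, h⟩ := (CompactConvergenceCLM.hasBasis_nhds_zero_of_basis
    (Metric.nhds_basis_closedBall (x := (0 : 𝕜)))).mem_iff.1 hV
  refine ⟨((ε⁻¹ : ℝ) : 𝕜) • K, hK.smul _, fun f hf => h fun x hx => ?_⟩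
  have := hf _ (Set.smul_mem_smul_set hx)
  rw [map_smul, norm_smul, RCLike.norm_ofReal, abs_of_pos (inv_pos.2 hε), inv_mul_le_iff₀ hε,
    mul_one] at this
  simpa using this

theorem CompactConvergenceCLM.locallyConvexSpace_real : LocallyConvexSpace ℝ (E →L_c[𝕜] 𝕜) :=
  UniformConvergenceCLM.locallyConvexSpace ℝ _ ⟨∅, isCompact_empty⟩
    (directedOn_of_sup_mem fun _ _ => IsCompact.union)

end

/-! ### The two implications -/

section

variable {𝕜 : Type*} [RCLike 𝕜] {E : Type*} [AddCommGroup E] [Module 𝕜 E]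
    [Module ℝ E] [IsScalarTower ℝ 𝕜 E] [TopologicalSpace E] [IsTopologicalAddGroup E]
    [ContinuousSMul 𝕜 E]

theorem HasApproxOrder.norm_det_le (hE : HasApproxOrder 𝕜 E 4) {K U : Set E} (hK : IsCompact K)
    (hU : U ∈ 𝓝 (0 : E)) : ∃ D : ℝ, 0 < D ∧ ∀ k : ℕ, 1 ≤ k →
      ∀ (x : Fin k → E) (ψ : Fin k → Module.Dual 𝕜 E), (∀ i, x i ∈ K) →
      (∀ j, ∀ u ∈ U, ‖ψ j u‖ ≤ 1) → ‖(Matrix.of fun i j => ψ j (x i)).det‖ ≤ (D / k) ^ k := by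
  have : ContinuousSMul ℝ E := IsScalarTower.continuousSMul 𝕜
  obtain ⟨W, hW, C, hC, hWk⟩ := hE U hU
  obtain ⟨s, hs, hsK⟩ := hK.exists_pos_subset_smul hW
  obtain ⟨t, ht, htK⟩ := hK.exists_pos_subset_smul hU
  refine ⟨8 * (1 + t + s * C), by positivity, fun k hk x ψ hx hψ => ?_⟩
  obtain ⟨r, hr1, hkr, hrk⟩ : ∃ r, 1 ≤ r ∧ k ≤ 2 * r ∧ 2 * r ≤ k + 1 :=
    ⟨(k + 1) / 2, by omega, by omega, by omega⟩
  have hr0 : (1 : ℝ) ≤ r := by exact_mod_cast hr1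
  obtain ⟨c, hc, hcC, L, hL, hWL⟩ := hWk r hr1
  have hdec : ∀ i, ∃ u ∈ U, ∃ l ∈ L, x i = (s * c) • u + l := by
    intro i
    obtain ⟨w, hw, hwx⟩ := hsK (hx i)
    obtain ⟨_, ⟨u, hu, rfl⟩, l, hl, rfl⟩ := Set.mem_add.1 (hWL hw)
    refine ⟨u, hu, s • l, ?_, ?_⟩
    · rw [← algebraMap_smul 𝕜 s l]
      exact L.smul_mem _ hl
    · rw [← hwx]
      simp only [smul_add, mul_smul]
  choose u hu l hl hxl using hdec
  have hsc : 0 < s * c := by positivity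
  have hS : ∀ i j, ‖ψ j ((s * c) • u i)‖ ≤ s * C / r ^ 4 := by
    intro i j
    rw [norm_map_real_smul, abs_of_pos hsc, mul_div_assoc]
    calc s * c * ‖ψ j (u i)‖ ≤ s * c * 1 := by gcongr; exact hψ j _ (hu i)
      _ ≤ s * (C / r ^ 4) := by rw [mul_one]; gcongr
  have hS1 : s * C / r ^ 4 ≤ s * C := div_le_self (by positivity) (one_le_pow₀ hr0)
  refine norm_det_le_of_eq_add hk hkr hrk (Matrix.of fun i j => ψ j ((s * c) • u i)) hL hl ψ
    (fun i j => by simp [hxl i]) (by nlinarith [mul_pos hs hC]) (fun i j => ?_) fun i j => ?_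
  · refine (hS i j).trans ?_
    gcongr
    linarith
  -- The low-rank part is bounded as the difference of the full entry and the small one.
  · have hxi : ‖ψ j (x i)‖ ≤ t := by
      obtain ⟨v, hv, hvx⟩ := htK (hx i)
      have hvx' : t • v = x i := hvx
      rw [← hvx', norm_map_real_smul, abs_of_pos ht]
      exact mul_le_of_le_one_right ht.le (hψ j v hv)
    have : ψ j (l i) = ψ j (x i) - ψ j ((s * c) • u i) := by
      rw [hxl i, map_add, add_sub_cancel_left]
    rw [this]
    linarith [norm_sub_le (ψ j (x i)) (ψ j ((s * c) • u i)), hS i j]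

theorem IsNuclearLCS.dual (hk : IsKOmegaSpace E) (hE : IsNuclearLCS 𝕜 E) :
    IsNuclearLCS 𝕜 (E →L_c[𝕜] 𝕜) := by
  have : ContinuousSMul ℝ E := IsScalarTower.continuousSMul 𝕜
  have : CompactlyCoherentSpace E := hk.final_topology
  have : LocallyConvexSpace ℝ (E →L_c[𝕜] 𝕜) := CompactConvergenceCLM.locallyConvexSpace_real
  have h1 := hE.hasApproxOrder_one
  have h4 : HasApproxOrder 𝕜 E 4 := (h1.add h1).add (h1.add h1)
  refine IsNuclearLCS.of_approx fun V hV => ?_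
  obtain ⟨K₀, hK₀, hKV⟩ := CompactConvergenceCLM.exists_polar_subset hV
  obtain ⟨K, hmono, hK, hcob⟩ := hk.exists_monotone_cobasis
  have key : ∃ n : ℕ, ∀ k : ℕ, 1 ≤ k → ∀ (f : Fin k → (E →L_c[𝕜] 𝕜)) (x : Fin k → E),
      (∀ i, ∀ y ∈ K n, ‖f i y‖ ≤ 1 / 2) → (∀ j, x j ∈ K₀) →
      ‖(Matrix.of fun i j => f i (x j)).det‖ ≤ ((n + 1) / k) ^ k := by
    by_contra! hcon
    choose k hk1 f x hf hx hdet using hcon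
    -- All the counterexample functionals are bounded by `1` on this single neighbourhood of `0`, so
    -- one constant `D` controls all their determinants, contradicting the case `n ≥ D`.
    have hopen : IsOpen (⋂ n, {y | ∀ i, ‖f n i y‖ < 1}) := by
      refine isOpen_iInter_of_cobasis hmono hcob (fun n => ?_) fun n y hy i =>
        (hf n i y hy).trans_lt one_half_lt_one
      rw [Set.ofPred_forall]
      exact isOpen_iInter_of_finite fun i =>
        isOpen_lt (map_continuous (f n i)).norm continuous_const
    obtain ⟨D, hD, hdetD⟩ := HasApproxOrder.norm_det_le h4 hK₀
      (hopen.mem_nhds (by simp) : _ ∈ 𝓝 (0 : E))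
    obtain ⟨n, hn⟩ := exists_nat_ge D
    have hk0 : (0 : ℝ) < k n := by exact_mod_cast hk1 n
    refine (hdet n).not_ge ?_
    rw [← Matrix.det_transpose]
    refine (hdetD (k n) (hk1 n) (x n) (fun i => (f n i).toLinearMap) (hx n) fun i u hu =>
      (Set.mem_iInter.1 hu n i).le).trans ?_
    gcongr
    linarith
  obtain ⟨n, hn⟩ := key
  refine ⟨{f | ∀ y ∈ K n, ‖f y‖ ≤ 1 / 2}, CompactConvergenceCLM.polar_mem_nhds (hK n) one_half_pos,
    ⟨fun f hf y hy => ?_, ?_⟩, n + 1, by positivity, fun k hk1 => ?_⟩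
  · simpa using hf y hy
  · intro f hf g hg a b ha hb hab y hy
    calc ‖(a • f + b • g) y‖ = ‖a • f y + b • g y‖ := rfl
      _ ≤ a * ‖f y‖ + b * ‖g y‖ := by
        refine (norm_add_le _ _).trans ?_
        rw [norm_smul, norm_smul, Real.norm_of_nonneg ha, Real.norm_of_nonneg hb]
      _ ≤ a * (1 / 2) + b * (1 / 2) := by gcongr; exacts [hf y hy, hg y hy]
      _ = 1 / 2 := by linear_combination (1 / 2) * hab
  · have hk0 : (0 : ℝ) < k := by exact_mod_cast hk1
    obtain ⟨L, hL, hsub⟩ := exists_submodule_subset_of_norm_det_le (𝕜 := 𝕜)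
      (A := {f : E →L_c[𝕜] 𝕜 | ∀ y ∈ K n, ‖f y‖ ≤ 1 / 2}) (Φ := evalDual 𝕜 '' K₀)
      (c := (n + 1) / k) (by positivity) hk1 (fun a φ ha hφ => by
        choose x hx hxφ using hφ
        simpa [← hxφ] using hn k hk1 a x ha hx)
    refine ⟨L, hL, hsub.trans (Set.add_subset_add_right (Set.smul_set_mono ?_))⟩
    refine fun f hf => hKV fun y hy => hf _ ⟨y, hy, rfl⟩

theorem IsNuclearLCS.of_dual [LocallyConvexSpace ℝ E] (hk : IsKOmegaSpace E)
    (hF : IsNuclearLCS 𝕜 (E →L_c[𝕜] 𝕜)) : IsNuclearLCS 𝕜 E := by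
  have : ContinuousSMul ℝ E := IsScalarTower.continuousSMul 𝕜
  have : CompactlyCoherentSpace E := hk.final_topology
  have h1 := hF.hasApproxOrder_one
  -- The determinant estimate needs order `4`; the extra power absorbs the growth in `n` of the
  -- constants `D n`.
  have h5 : HasApproxOrder 𝕜 (E →L_c[𝕜] 𝕜) 5 := (h1.add h1).add ((h1.add h1).add h1)
  refine IsNuclearLCS.of_approx fun U hU => ?_
  obtain ⟨p, hp, hpU, hpf⟩ := exists_seminorm_le_one_subset (𝕜 := 𝕜) hU
  obtain ⟨K, hmono, hK, hcob⟩ := hk.exists_monotone_cobasis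
  have happ : ∀ n, ∃ D : ℝ, 0 < D ∧ ∀ k : ℕ, 1 ≤ k → ∃ c : ℝ, 0 < c ∧ c ≤ D / (k : ℝ) ^ 5 ∧
      ∃ L : Submodule 𝕜 (E →L_c[𝕜] 𝕜), Module.rank 𝕜 L < k ∧
        {f : E →L_c[𝕜] 𝕜 | ∀ x, ‖f x‖ ≤ p x} ⊆
          c • {f : E →L_c[𝕜] 𝕜 | ∀ x ∈ K n, ‖f x‖ ≤ 1} + (L : Set (E →L_c[𝕜] 𝕜)) := by
    intro n
    obtain ⟨V, hV, C, hC, hVk⟩ :=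
      h5 _ (CompactConvergenceCLM.polar_mem_nhds (𝕜 := 𝕜) (hK n) one_pos)
    obtain ⟨K', hK', hKV⟩ := CompactConvergenceCLM.exists_polar_subset hV
    -- As `p` is bounded on `K'`, the functionals dominated by `p` lie in a multiple of `V`.
    obtain ⟨M, hM⟩ := hK'.bddAbove_image hp.continuousOn
    have hM' : ∀ x ∈ K', p x ≤ max M 1 := fun x hx =>
      (hM ⟨x, hx, rfl⟩).trans (le_max_left _ _)
    have hMpos : 0 < max M 1 := lt_max_of_lt_right one_pos
    generalize max M 1 = s at hM' hMpos
    refine ⟨s * C, by positivity, fun k hk1 => ?_⟩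
    obtain ⟨c, hc, hcC, L, hL, hVL⟩ := hVk k hk1
    refine ⟨s * c, by positivity, ?_, L, hL, fun f hf => ?_⟩
    · rw [mul_div_assoc]
      gcongr
    have hfV : s⁻¹ • f ∈ V := by
      refine hKV fun x hx => ?_
      have : ‖(s⁻¹ • f) x‖ = s⁻¹ * ‖f x‖ := by
        rw [← Real.norm_of_nonneg (inv_pos.2 hMpos).le, ← norm_smul,
          Real.norm_of_nonneg (inv_pos.2 hMpos).le]
        rfl
      rw [this, inv_mul_le_iff₀ hMpos, mul_one]
      exact (hf x).trans (hM' x hx)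
    obtain ⟨_, ⟨u, hu, rfl⟩, l, hl, hul⟩ := Set.mem_add.1 (hVL hfV)
    refine Set.mem_add.2 ⟨(s * c) • u, ⟨u, hu, rfl⟩, s • l, ?_, ?_⟩
    · rw [SetLike.mem_coe, ← algebraMap_smul 𝕜 s l]
      exact L.smul_mem _ hl
    · have hul' : c • u + l = s⁻¹ • f := hul
      calc (s * c) • u + s • l = s • (c • u + l) := by
            rw [mul_smul]
            exact (smul_add s (c • u) l).symm
        _ = f := by rw [hul', smul_inv_smul₀ hMpos.ne']
  choose D₀ hD₀ happ using happ
  obtain ⟨D, hD, hD₀D, hDn⟩ : ∃ D : ℕ → ℝ, (∀ n, 0 < D n) ∧ (∀ n, D₀ n ≤ D n) ∧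
      ∀ n : ℕ, (n : ℝ) < D n := by
    refine ⟨fun n => D₀ n + n + 1, fun n => ?_, fun n => ?_, fun n => ?_⟩ <;>
    linarith [hD₀ n, (Nat.cast_nonneg n : (0 : ℝ) ≤ n)]
  let δ : ℕ → ℝ := fun n => (D 0 / D (n + 1)) ^ 4
  have hδ : ∀ n, 0 < δ n := fun n => by have := hD 0; have := hD (n + 1); positivity
  let B : ℕ → Set E := fun n =>
    {y | ∀ u : E →L_c[𝕜] 𝕜, (∀ x ∈ K n, ‖u x‖ ≤ 1) → ‖u y‖ ≤ 1}
  have hballopen : IsOpen (p.ball 0 1) := by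
    rw [Seminorm.ball_zero_eq]
    exact isOpen_lt hp continuous_const
  have hB0 : ∀ n, (0 : E) ∈ B n := fun n u _ => by simp
  have hball0 : ∀ n, (0 : E) ∈ δ n • p.ball 0 1 := fun n => ⟨0, by simp, by simp⟩
  -- The bipolar `B n` of `K n` need not be open; adding a small ball gives an open set containing
  -- `K n`.
  let W : Set E := p.ball 0 1 ∩ ⋂ n, (B n + δ n • p.ball 0 1)
  have hWo : IsOpen W := by
    refine hballopen.inter (isOpen_iInter_of_cobasis hmono hcob (fun n => ?_) fun n y hy => ?_)
    · exact (hballopen.smul₀ (hδ n).ne').add_left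
    · exact Set.mem_add.2 ⟨y, fun u hu => hu y hy, 0, hball0 n, add_zero y⟩
  have hW0 : (0 : E) ∈ W :=
    ⟨by simp, Set.mem_iInter.2 fun n => Set.mem_add.2 ⟨0, hB0 n, 0, hball0 n, add_zero 0⟩⟩
  have hBconv : ∀ n, Convex ℝ (B n) := by
    intro n x hx y hy a b ha hb hab u hu
    calc ‖u (a • x + b • y)‖ ≤ ‖u (a • x)‖ + ‖u (b • y)‖ := by
          rw [map_add]; exact norm_add_le _ _
      _ = a * ‖u x‖ + b * ‖u y‖ := by
          have h := norm_map_real_smul (ContinuousLinearMap.toLinearMap u : Module.Dual 𝕜 E)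
          have hx := h a x
          have hy := h b y
          rw [abs_of_nonneg ha] at hx
          rw [abs_of_nonneg hb] at hy
          exact congrArg₂ (· + ·) hx hy
      _ ≤ a * 1 + b * 1 := by gcongr; exacts [hx u hu, hy u hu]
      _ = 1 := by linarith
  have hWs : IsSymmConvex W := by
    refine ⟨fun x hx => ⟨by simpa using hx.1, Set.mem_iInter.2 fun n => ?_⟩,
      (p.convex_ball 0 1).inter (convex_iInter fun n =>
        (hBconv n).add ((p.convex_ball 0 1).smul (δ n)))⟩
    obtain ⟨y, hy, _, ⟨v, hv, rfl⟩, rfl⟩ := Set.mem_add.1 (Set.mem_iInter.1 hx.2 n)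
    refine Set.mem_add.2 ⟨-y, fun u hu => ?_, δ n • -v, ⟨-v, by simpa using hv, rfl⟩, ?_⟩
    · simpa using hy u hu
    · simp only [smul_neg, neg_add]
  have hdet : ∀ N : ℕ, 1 ≤ N → ∀ (w : Fin N → E) (a : Fin N → (E →L_c[𝕜] 𝕜)), (∀ i, w i ∈ W) →
      (∀ j x, ‖a j x‖ ≤ p x) →
      ‖(Matrix.of fun j i => a j (w i)).det‖ ≤ (8 * (D 0 + 2) / N) ^ N := by
    intro N hN w a hw ha
    obtain ⟨r, hr1, hNr, hrN⟩ : ∃ r, 1 ≤ r ∧ N ≤ 2 * r ∧ 2 * r ≤ N + 1 :=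
      ⟨(N + 1) / 2, by omega, by omega, by omega⟩
    have hr0 : (1 : ℝ) ≤ r := by exact_mod_cast hr1
    -- This `n` balances both errors: `D n ≤ D 0 * r` reduces `D n / r ^ 5` to `D 0 / r ^ 4`, and `D
    -- 0 * r < D (n + 1)` gives `δ n ≤ 1 / r ^ 4`.
    obtain ⟨n, hn, hn1⟩ : ∃ n, D n ≤ D 0 * r ∧ D 0 * r < D (n + 1) := by
      have hex : ∃ m, D 0 * r < D m := by
        obtain ⟨m, hm⟩ := exists_nat_ge (D 0 * r)
        exact ⟨m, hm.trans_lt (hDn m)⟩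
      classical
      have hne : Nat.find hex ≠ 0 := fun h0 => by
        have h := Nat.find_spec hex
        rw [h0] at h
        nlinarith [hD 0]
      obtain ⟨n, hn⟩ := Nat.exists_eq_succ_of_ne_zero hne
      exact ⟨n, not_lt.1 (Nat.find_min hex (by omega)), by simpa only [hn] using Nat.find_spec hex⟩
    have hδr : δ n ≤ 1 / (r : ℝ) ^ 4 := by
      have : D 0 / D (n + 1) ≤ 1 / r := by
        rw [div_le_div_iff₀ (hD _) (by positivity)]
        linarith
      calc δ n ≤ (1 / (r : ℝ)) ^ 4 := pow_le_pow_left₀ (div_pos (hD _) (hD _)).le this 4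
        _ = _ := by rw [div_pow, one_pow]
    obtain ⟨c, hc, hcD, L, hL, hAL⟩ := happ n r hr1
    have hcr : c ≤ D 0 / (r : ℝ) ^ 4 := by
      refine hcD.trans ?_
      rw [div_le_div_iff₀ (by positivity) (by positivity)]
      calc D₀ n * (r : ℝ) ^ 4 ≤ D 0 * r * (r : ℝ) ^ 4 := by gcongr; exact (hD₀D n).trans hn
        _ = _ := by ring
    have hdecw : ∀ i, ∃ y ∈ B n, ∃ v, p v < 1 ∧ w i = y + δ n • v := by
      intro i
      obtain ⟨y, hy, _, ⟨v, hv, rfl⟩, h⟩ := Set.mem_add.1 (Set.mem_iInter.1 (hw i).2 n)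
      exact ⟨y, hy, v, by simpa using hv, h.symm⟩
    have hdeca : ∀ j, ∃ u : E →L_c[𝕜] 𝕜, (∀ x ∈ K n, ‖u x‖ ≤ 1) ∧ ∃ l ∈ L, a j = c • u + l := by
      intro j
      obtain ⟨_, ⟨u, hu, rfl⟩, l, hl, h⟩ := Set.mem_add.1 (hAL (ha j))
      exact ⟨u, hu, l, hl, h.symm⟩
    choose y hy v hv hwy using hdecw
    choose u hu l hl hal using hdeca
    -- With `w i = y i + δ n • v i` and `a j = c • u j + l j`, only `l j (y i)` is left out of `S`;
    -- it has low rank because `l j ∈ L`.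
    let S : Matrix (Fin N) (Fin N) 𝕜 :=
      Matrix.of fun j i => evalDual 𝕜 (y i) (c • u j) + a j (δ n • v i)
    have hdec : ∀ j i, a j (w i) = S j i + evalDual 𝕜 (y i) (l j) := by
      intro j i
      have h : a j (y i) = evalDual 𝕜 (y i) (c • u j) + evalDual 𝕜 (y i) (l j) := by
        rw [← map_add, ← hal j, evalDual_apply]
      rw [hwy i, map_add, h]
      simp only [S, Matrix.of_apply]
      ring
    have hS : ∀ j i, ‖S j i‖ ≤ (D 0 + 1) / (r : ℝ) ^ 4 := by
      intro j i
      have e1 : ‖evalDual 𝕜 (y i) (c • u j)‖ ≤ D 0 / (r : ℝ) ^ 4 := by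
        rw [norm_map_real_smul, abs_of_pos hc]
        exact (mul_le_of_le_one_right hc.le (hy i (u j) (hu j))).trans hcr
      have e2 : ‖a j (δ n • v i)‖ ≤ 1 / (r : ℝ) ^ 4 := by
        have h := norm_map_real_smul
          (ContinuousLinearMap.toLinearMap (a j) : Module.Dual 𝕜 E) (δ n) (v i)
        rw [abs_of_pos (hδ n)] at h
        refine h.le.trans ((mul_le_of_le_one_right (hδ n).le ?_).trans hδr)
        exact (ha j _).trans (hv i).le
      rw [add_div]
      exact (norm_add_le _ _).trans (add_le_add e1 e2)
    have hD0 := hD 0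
    refine norm_det_le_of_eq_add hN hNr hrN S hL hl (fun i => evalDual 𝕜 (y i))
      (fun j i => hdec j i) (by linarith) (fun j i => (hS j i).trans ?_) fun j i => ?_
    · gcongr
      linarith
    · have e : evalDual 𝕜 (y i) (l j) = a j (w i) - S j i := by rw [hdec j i, add_sub_cancel_left]
      have e1 : ‖a j (w i)‖ ≤ 1 := (ha j _).trans (by simpa using (hw i).1 : p (w i) < 1).le
      have e2 : (D 0 + 1) / (r : ℝ) ^ 4 ≤ D 0 + 1 :=
        div_le_self (by linarith) (one_le_pow₀ hr0)
      rw [e]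
      linarith [norm_sub_le (a j (w i)) (S j i), hS j i]
  refine ⟨W, hWo.mem_nhds hW0, hWs, 8 * (D 0 + 2), by have := hD 0; positivity, fun k hk1 => ?_⟩
  have hk0 : (0 : ℝ) < k := by exact_mod_cast hk1
  obtain ⟨L, hL, hsub⟩ := exists_submodule_subset_of_norm_det_le (𝕜 := 𝕜)
    (A := W) (Φ := {φ | ∃ f : E →L_c[𝕜] 𝕜, (∀ x, ‖f x‖ ≤ p x) ∧ ∀ x, φ x = f x})
    (c := 8 * (D 0 + 2) / k) (by have := hD 0; positivity) hk1 (fun w φ hw hφ => by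
      choose a ha haφ using hφ
      rw [← Matrix.det_transpose]
      simpa [haφ, Matrix.transpose] using hdet k hk1 w a hw ha)
  refine ⟨L, hL, hsub.trans (Set.add_subset_add_right (Set.smul_set_mono ?_))⟩
  intro x hx
  obtain ⟨f, hf, hfx⟩ := hpf x
  refine hpU (?_ : p x ≤ 1)
  rw [← hfx]
  exact hx f.toLinearMap ⟨f, hf, fun _ => rfl⟩

end

/-- `E →L_c[𝕜] 𝕜` is the space of continuous linear functionals on `E` with the topology of uniform
convergence on compact sets, that is, the compact-open topology. -/
theorem mainTheorem3 {𝕜 : Type*} [RCLike 𝕜] {E : Type*} [AddCommGroup E] [Module 𝕜 E]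
    [Module ℝ E] [IsScalarTower ℝ 𝕜 E] [TopologicalSpace E] [IsTopologicalAddGroup E]
    [ContinuousSMul 𝕜 E] [LocallyConvexSpace ℝ E] (hE : IsKOmegaSpace E) :
    IsNuclearLCS 𝕜 (E →L_c[𝕜] 𝕜) ↔ IsNuclearLCS 𝕜 E :=
  ⟨IsNuclearLCS.of_dual hE, IsNuclearLCS.dual hE⟩
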